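/- **Setting.** Let $P<N$, $c\in\mathbb{R}^N$, let $A\in\mathbb{R}^{P\times N}$ have full row rank, and let $b_0,b_1,\dots\in\mathbb{R}^P$. For $i=1,\dots,I$ let $K_i\subset\mathbb{R}^{q_i}$ be a proper cone (closed, convex, with nonempty interior, containing no line) and $g_i:\mathbb{R}^N\to\mathbb{R}^{q_i}$ be convex with respect to $K_i$. Write $D_t=\{x: g_i(x)\preceq_{K_i}0\ \forall i,\ Ax=b_t\}$ and let $\mathcal X_t$ be the set of minimizers of $c^\top x$ over $D_t$; $x_t^*$ denotes any element of $\mathcal X_t$. Let $\psi_i$ be a generalized logarithm for $K_i$ (a closed concave $C^2$ function on $\operatorname{int}K_i$ with negative definite Hessian and $\psi_i(sy)=\psi_i(y)+\theta_i\log s$ for all $s>0$, for some $\theta_i>0$; for instance $\log$ when $K_i=\mathbb{R}_+$). Let $\phi(x)=-\sum_i\psi_i(-g_i(x))$ with domain $\operatorname{dom}\phi=\{x: g_i(x)\prec_{K_i}0\ \forall i\}$, and $d_\eta(x)=\eta c^\top x+\phi(x)$. For a symmetric matrix $M$ put $\|z\|_M=\sqrt{z^\top Mz}$, and for $y=(x,\nu)\in\mathbb{R}^N\times\mathbb{R}^P$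 put $$\mathbf D(y)=\begin{bmatrix}\nabla^2\phi(x)&A^\top\\A&0\end{bmatrix},\quad r_t(y,\eta)=\begin{bmatrix}\nabla d_\eta(x)+A^\top\nu\\Ax-b_t\end{bmatrix},\quad n_t(y,\eta)=-\mathbf D(y)^{-1}r_t(y,\eta).$$ **Algorithm (OIPM-TEC).** From $y_0=(x_0,\nu_0)$, $\eta_0>0$ and $\beta$, for $t=0,1,2,\dots$: implement $x_t$, observe $b_t$, perform the $t$-step $\tilde y_t=(\tilde x_t,\tilde\nu_t)=y_t+n_t(y_t,\eta_t)$, set $\eta_{t+1}=\beta\eta_t$, and perform the $\eta$-step $y_{t+1}=\tilde y_t-\mathbf D(\tilde y_t)^{-1}\begin{bmatrix}\nabla d_{\eta_{t+1}}(\tilde x_t)+A^\top\nu_t\\0\end{bmatrix}$. (The decisions $x_t$ do not depend on the multiplier used in the last bracket; with $\tilde\nu_t$ in place of $\nu_t$ this is the Newton step $n_t(\tilde y_t,\eta_{t+1})$.) **Performance measures.** With $\operatorname{dist}_i(x)$ the distance from $x$ to $\{z:g_i(z)\preceq_{K_i}0\}$ and $H_d$ the Hausdorff distance, let $$R_d(T)=\sum_{t=1}^T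 c^\top(x_t-x_t^*),\qquad \mathrm{Vio}(T)=\sum_{t=1}^T\Big[\sum_i\operatorname{dist}_i(x_t)+\|Ax_t-b_t\|\Big],$$ $$V_T=\sum_{t=1}^T H_d(\mathcal X_t,\mathcal X_{t-1}),\qquad V_b=\sum_{t=1}^T\|b_t-b_{t-1}\|.$$ **Theorem 1.** Let $v_f,m,\eta_0>0$ and $1<\beta\le 1+\frac1{8\sqrt{v_f}}$. Assume that $\phi$ is a self-concordant barrier functional of complexity at most $v_f$: it is $C^2$ with positive definite Hessian on $\operatorname{dom}\phi$; whenever $x_1\in\operatorname{dom}\phi$ and $\rho:=\|x_2-x_1\|_{\nabla^2\phi(x_1)}<1$, then $x_2\in\operatorname{dom}\phi$ and $\|v\|_{\nabla^2\phi(x_2)}/\|v\|_{\nabla^2\phi(x_1)}\le\frac1{1-\rho}$ for all $v\neq0$; and $\nabla\phi(x)^\top\nabla^2\phi(x)^{-1}\nabla\phi(x)\le v_f$ on $\operatorname{dom}\phi$. Let $x_0\in\operatorname{dom}\phi$ with $Ax_0=b_0$ and $\nu_0\in\mathbb{R}^P$ satisfy $\|n_0(y_0,\eta_0)\|_{\mathbf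 D(y_0)}\le\frac19$. Let $T\ge0$ and assume, for all $0\le t\le T$: $D_t$ is closed, convex and nonempty; $\|\mathbf D(y)^{-1}\|\le\frac1m$ (spectral norm) for all $y=(x,\nu)$ with $x\in D_t\cap\operatorname{dom}\phi$; and $\|b_t-b_{t-1}\|\le\sqrt{3m/160}$ if $t\ge1$. Then for all $t\le T$ the iterates $x_t,\tilde x_t$ lie in $\operatorname{dom}\phi$, the matrices $\mathbf D(y_t),\mathbf D(\tilde y_t)$ are invertible, and $\mathcal X_t$ is nonempty and bounded; moreover $$R_d(T)\le\frac{11v_f\beta}{5\eta_0(\beta-1)}+\|c\|\,V_T,\qquad \mathrm{Vio}(T)\le V_b .$$ Consequently, if the assumptions hold for every $T$, then $R_d(T)=O(V_T+1)$ and $\mathrm{Vio}(T)=O(V_b)$ as $T\to\infty$. -/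

import Mathlib

open Matrix Filter Asymptotics

noncomputable section

namespace OIPM

/-- `ℝⁿ` with the Euclidean norm. -/
abbrev Vec (n : ℕ) := EuclideanSpace ℝ (Fin n)

/-- The product `M x` of a matrix and a Euclidean vector, as a Euclidean vector. -/
def mulV {p n : ℕ} (M : Matrix (Fin p) (Fin n) ℝ) (x : Vec n) : Vec p :=
  WithLp.toLp 2 (M *ᵥ x.ofLp)

/-- The Hessian matrix `∇² f(x)`. -/
def hessian {n : ℕ} (f : Vec n → ℝ) (x : Vec n) : Matrix (Fin n) (Fin n) ℝ :=
  Matrix.of fun i j =>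
    fderiv ℝ (fderiv ℝ f) x (EuclideanSpace.single i 1) (EuclideanSpace.single j 1)

/-- The norm `‖z‖_M = √(zᵀ M z)` induced by a matrix `M`. -/
def matNorm {ι : Type*} [Fintype ι] (M : Matrix ι ι ℝ) (z : ι → ℝ) : ℝ :=
  Real.sqrt (z ⬝ᵥ (M *ᵥ z))

/-- A generalized logarithm for the cone `K`: a concave, closed, twice continuously
differentiable function on the interior of `K`, with negative definite Hessian, which is
logarithmically homogeneous of some degree `θ > 0`. -/
structure IsGeneralizedLog {E : Type*} [NormedAddCommGroup E] [NormedSpace ℝ E]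
    (K : Set E) (ψ : E → ℝ) : Prop where
  concave : ConcaveOn ℝ (interior K) ψ
  closed : ∀ a : ℝ, IsClosed {y | y ∈ interior K ∧ a ≤ ψ y}
  contDiffOn : ContDiffOn ℝ 2 ψ (interior K)
  hess_neg : ∀ y ∈ interior K, ∀ v : E, v ≠ 0 → fderiv ℝ (fderiv ℝ ψ) y v v < 0
  log_homogeneous : ∃ θ : ℝ, 0 < θ ∧
    ∀ y ∈ interior K, ∀ s : ℝ, 0 < s → ψ (s • y) = ψ y + θ * Real.log s

/-- `f` is a (nondegenerate) self-concordant functional with domain `S`: it is `C²` with positive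
definite Hessian on `S`, and for `x₁ ∈ S` every `x₂` with `‖x₂ - x₁‖_{∇²f(x₁)} < 1` lies in the
domain and satisfies `‖v‖_{∇²f(x₂)} / ‖v‖_{∇²f(x₁)} ≤ 1 / (1 - ‖x₂ - x₁‖_{∇²f(x₁)})`. -/
structure IsSelfConcordantOn {n : ℕ} (f : Vec n → ℝ) (S : Set (Vec n)) : Prop where
  contDiffOn : ContDiffOn ℝ 2 f S
  posDef : ∀ x ∈ S, (hessian f x).PosDef
  ball_subset : ∀ x₁ ∈ S, ∀ x₂ : Vec n,
    matNorm (hessian f x₁) (x₂ - x₁).ofLp < 1 → x₂ ∈ S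
  ratio_le : ∀ x₁ ∈ S, ∀ x₂ : Vec n, matNorm (hessian f x₁) (x₂ - x₁).ofLp < 1 →
    ∀ v : Vec n, v ≠ 0 →
      matNorm (hessian f x₂) v.ofLp / matNorm (hessian f x₁) v.ofLp
        ≤ 1 / (1 - matNorm (hessian f x₁) (x₂ - x₁).ofLp)

/-- The data of the time-varying equality-constrained conic problem
`min cᵀx  s.t.  g i x ⪯_{K i} 0 (i = 1, …, I),  A x = b t`.
Mathlib's `ProperCone` is a closed convex cone containing `0`; the fields `K_solid` and
`K_salient` add the nonempty interior and the absence of lines. -/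
structure Problem (N P I : ℕ) where
  c : Vec N
  A : Matrix (Fin P) (Fin N) ℝ
  b : ℕ → Vec P
  q : Fin I → ℕ
  K : (i : Fin I) → ProperCone ℝ (Vec (q i))
  g : (i : Fin I) → Vec N → Vec (q i)
  /-- the generalized logarithm used for the cone `K i` -/
  ψ : (i : Fin I) → Vec (q i) → ℝ
  P_lt_N : P < N
  A_rank : A.rank = P
  K_solid : ∀ i, (interior (K i : Set (Vec (q i)))).Nonempty
  K_salient : ∀ i, ∀ y ∈ K i, y ≠ 0 → -y ∉ K i
  g_convex : ∀ i, ∀ x y : Vec N, ∀ s : ℝ, 0 ≤ s → s ≤ 1 →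
    (s • g i x + (1 - s) • g i y) - g i (s • x + (1 - s) • y) ∈ K i
  ψ_genLog : ∀ i, IsGeneralizedLog (K i : Set (Vec (q i))) (ψ i)

namespace Problem

variable {N P I : ℕ} (pb : Problem N P I)

/-- The objective `f(x) = cᵀ x`. -/
def cost (x : Vec N) : ℝ := inner ℝ pb.c x

/-- `{x | g i x ⪯_{K i} 0}`. -/
def ineqSet (i : Fin I) : Set (Vec N) := {x | -(pb.g i x) ∈ pb.K i}

/-- The feasible set `D_t`. -/
def feasible (t : ℕ) : Set (Vec N) := {x | (∀ i, x ∈ pb.ineqSet i) ∧ mulV pb.A x = pb.b t}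

/-- The set `X_t` of optimal decisions of round `t`. -/
def optimal (t : ℕ) : Set (Vec N) :=
  {x | x ∈ pb.feasible t ∧ ∀ z ∈ pb.feasible t, pb.cost x ≤ pb.cost z}

/-- The domain `{x | g i x ≺_{K i} 0 for all i}` of the barrier. -/
def dom : Set (Vec N) := {x | ∀ i, -(pb.g i x) ∈ interior (pb.K i : Set (Vec (pb.q i)))}

/-- The barrier functional `φ(x) = ∑ i, -log (-g i x)`, with generalized logarithms. -/
def barrier (x : Vec N) : ℝ := ∑ i, -(pb.ψ i (-(pb.g i x)))

/-- `d_η(x) = η cᵀx + φ(x)`. -/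
def penalized (η : ℝ) (x : Vec N) : ℝ := η * pb.cost x + pb.barrier x

/-- The matrix `D(y) = [∇²φ(x), Aᵀ; A, 0]`. -/
def kkt (x : Vec N) : Matrix (Fin N ⊕ Fin P) (Fin N ⊕ Fin P) ℝ :=
  Matrix.fromBlocks (hessian pb.barrier x) pb.Aᵀ pb.A 0

/-- The vector `r_t(y, η) = [∇d_η(x) + Aᵀν; A x - b_t]` at `y = (x, ν)`. -/
def residual (t : ℕ) (η : ℝ) (y : Vec N × Vec P) : Fin N ⊕ Fin P → ℝ :=
  Sum.elim (fun j => gradient (pb.penalized η) y.1 j + (pb.Aᵀ *ᵥ y.2.ofLp) j)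
    (fun k => mulV pb.A y.1 k - pb.b t k)

/-- The infeasible Newton step `n_t(y, η) = -D(y)⁻¹ r_t(y, η)`. -/
def newton (t : ℕ) (η : ℝ) (y : Vec N × Vec P) : Fin N ⊕ Fin P → ℝ :=
  -((pb.kkt y.1)⁻¹ *ᵥ pb.residual t η y)

/-- `y + Δ` for a primal-dual point `y = (x, ν)`. -/
def move (y : Vec N × Vec P) (Δ : Fin N ⊕ Fin P → ℝ) : Vec N × Vec P :=
  (WithLp.toLp 2 fun j => y.1 j + Δ (Sum.inl j), WithLp.toLp 2 fun k => y.2 k + Δ (Sum.inr k))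

/-- The `t`-step. -/
def tStep (t : ℕ) (η : ℝ) (y : Vec N × Vec P) : Vec N × Vec P := move y (pb.newton t η y)

/-- The `η`-step from `y' = (x', ν')`, with `ν` the multiplier in the residual, whose second block
is zero. -/
def etaStep (η : ℝ) (ν : Vec P) (y' : Vec N × Vec P) : Vec N × Vec P :=
  move y' (-((pb.kkt y'.1)⁻¹ *ᵥ
    Sum.elim (fun j => gradient (pb.penalized η) y'.1 j + (pb.Aᵀ *ᵥ ν.ofLp) j) 0))

/-- The barrier parameter `η_t`: `η_{t+1} = η_t β`. -/
def eta (η₀ β : ℝ) : ℕ → ℝ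
  | 0 => η₀
  | t + 1 => eta η₀ β t * β

/-- The iterates `y_t = (x_t, ν_t)` of the algorithm. -/
def iter (η₀ β : ℝ) (y₀ : Vec N × Vec P) : ℕ → Vec N × Vec P
  | 0 => y₀
  | t + 1 =>
    pb.etaStep (eta η₀ β (t + 1)) (iter η₀ β y₀ t).2
      (pb.tStep t (eta η₀ β t) (iter η₀ β y₀ t))

/-- The intermediate iterates `ỹ_t`, obtained from `y_t` by the `t`-step. -/
def mid (η₀ β : ℝ) (y₀ : Vec N × Vec P) (t : ℕ) : Vec N × Vec P :=
  pb.tStep t (eta η₀ β t) (pb.iter η₀ β y₀ t)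

/-- The barrier is a self-concordant barrier functional of complexity (at most) `vf`. -/
structure BarrierComplexity (vf : ℝ) : Prop where
  selfConcordant : IsSelfConcordantOn pb.barrier pb.dom
  complexity_le : ∀ x ∈ pb.dom,
    (gradient pb.barrier x).ofLp ⬝ᵥ
      ((hessian pb.barrier x)⁻¹ *ᵥ (gradient pb.barrier x).ofLp) ≤ vf

/-- The assumptions on the rounds `0, …, T`: each feasible set is closed, convex and nonempty;
`‖D(y)⁻¹‖ ≤ 1 / m` (spectral norm) at the feasible points where the barrier is defined; and
consecutive right-hand sides differ by at most `√(3m/160)`. -/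
structure RegularUpTo (m : ℝ) (T : ℕ) : Prop where
  closed : ∀ t ≤ T, IsClosed (pb.feasible t)
  convex : ∀ t ≤ T, Convex ℝ (pb.feasible t)
  nonempty : ∀ t ≤ T, (pb.feasible t).Nonempty
  kkt_inv_le : ∀ t ≤ T, ∀ x ∈ pb.feasible t, x ∈ pb.dom →
    ‖Matrix.toEuclideanCLM (n := Fin N ⊕ Fin P) (𝕜 := ℝ) (pb.kkt x)⁻¹‖ ≤ 1 / m
  step_le : ∀ t, 1 ≤ t → t ≤ T → ‖pb.b t - pb.b (t - 1)‖ ≤ Real.sqrt (3 * m / 160)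

/-- Dynamic regret of the decisions `x` against the round-optimal decisions `xs`. -/
def regret (x xs : ℕ → Vec N) (T : ℕ) : ℝ :=
  ∑ t ∈ Finset.Icc 1 T, (pb.cost (x t) - pb.cost (xs t))

/-- Constraint violation `Vio(T)` of the decisions `x`. -/
def violation (x : ℕ → Vec N) (T : ℕ) : ℝ :=
  ∑ t ∈ Finset.Icc 1 T,
    ((∑ i, Metric.infDist (x t) (pb.ineqSet i)) + ‖mulV pb.A (x t) - pb.b t‖)

/-- `V_T`, the cumulative Hausdorff variation of the optimal sets. -/
def optVariation (T : ℕ) : ℝ :=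
  ∑ t ∈ Finset.Icc 1 T, Metric.hausdorffDist (pb.optimal t) (pb.optimal (t - 1))

/-- `V_b`, the cumulative variation of the right-hand sides. -/
def rhsVariation (T : ℕ) : ℝ := ∑ t ∈ Finset.Icc 1 T, ‖pb.b t - pb.b (t - 1)‖

end Problem

end OIPM

end

/-
If the Newton decrement of `d_η` along `ker A` is at most `1/9` at a point of `{A x = b_{t-1}}`,
the infeasible `t`-step towards `{A x = b_t}` has squared local length at most
`(1/9)² + ‖D⁻¹‖ ‖b_t - b_{t-1}‖² ≤ 1/81 + 3/160 ≤ (3/17)²`, because its part that corrects the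
constraint is orthogonal to `ker A`. A Newton step of local length `r` leaves a decrement of at most
`r² / (1 - 2r)`, here `1/20`; passing to `β η` raises it to at most `1/5`, and the `η`-step brings
it back to `1/9`. Hence every `x_t` is strictly feasible for round `t - 1`: its inequality
violation is zero and its equality violation is exactly `‖b_t - b_{t-1}‖`.

For such a near-central point the duality gap is at most `4 v_f / (3 η_t)`. This uses
`∇φ(x)ᵀ(y - x) ≤ 4/3 v_f - ‖y - x‖_x / 6` for `y` feasible: the bound `v_f` alone is the blow-up of
a Riccati inequality along the segment, and the extra linear term absorbs the error of not being
exactly central. The gaps sum geometrically, and exchanging the optimum of round `t - 1` for that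
of round `t` costs `‖c‖` times the Hausdorff distance of the optimal sets.
-/

namespace OIPM

theorem abs_bilin_le_sqrt_mul_sqrt {E : Type*} [AddCommGroup E] [Module ℝ E]
    {B Q : LinearMap.BilinForm ℝ E} (hB : B.IsSymm) (h : ∀ v, |B v v| ≤ Q v v) (v w : E) :
    |B v w| ≤ √(Q v v) * √(Q w w) := by
  have hQ : ∀ u, 0 ≤ Q u u := fun u => (abs_nonneg _).trans (h u)
  have hquad : ∀ s : ℝ, 0 ≤ Q v v * (s * s) + -2 * B v w * s + Q w w := by
    intro s
    have hsub := (abs_le.1 (h (s • v - w))).1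
    have hadd := (abs_le.1 (h (s • v + w))).2
    simp only [map_add, map_sub, map_smul, LinearMap.add_apply, LinearMap.sub_apply,
      LinearMap.smul_apply, smul_eq_mul, hB.eq w v] at hsub hadd
    linarith [LinearMap.BilinForm.isSymm_def.1 hB v w]
  have hdiscrim := discrim_le_zero hquad
  rw [discrim] at hdiscrim
  rw [← Real.sqrt_mul (hQ v)]
  exact Real.abs_le_sqrt (by linarith)

/- A solution of the Riccati inequality `g² ≤ ϑ g'` with `g 0 > ϑ` blows up before time `1`, since
`1 / g + s / ϑ` is nonincreasing. -/
theorem le_of_sq_le_mul_deriv {g g' : ℝ → ℝ} {ϑ : ℝ} (hϑ : 0 < ϑ)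
    (hg : ∀ s ∈ Set.Ico (0 : ℝ) 1, HasDerivAt g (g' s) s)
    (hle : ∀ s ∈ Set.Ico (0 : ℝ) 1, g s ^ 2 ≤ ϑ * g' s) : g 0 ≤ ϑ := by
  by_contra! hlt
  set τ := ϑ / g 0
  have hτ0 : 0 < τ := div_pos hϑ (hϑ.trans hlt)
  have hmem : ∀ s ∈ Set.Icc 0 τ, s ∈ Set.Ico (0 : ℝ) 1 := fun s hs =>
    ⟨hs.1, hs.2.trans_lt ((div_lt_one (hϑ.trans hlt)).2 hlt)⟩
  have hmem' : ∀ s ∈ interior (Set.Icc 0 τ), s ∈ Set.Ico (0 : ℝ) 1 := fun s hs =>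
    hmem s (interior_subset hs)
  have hmono : MonotoneOn g (Set.Icc 0 τ) :=
    monotoneOn_of_hasDerivWithinAt_nonneg (convex_Icc 0 τ)
      (fun s hs => (hg s (hmem s hs)).continuousAt.continuousWithinAt)
      (fun s hs => (hg s (hmem' s hs)).hasDerivWithinAt)
      fun s hs => (mul_nonneg_iff_of_pos_left hϑ).1 ((sq_nonneg _).trans (hle s (hmem' s hs)))
  have hpos : ∀ s ∈ Set.Icc 0 τ, 0 < g s := fun s hs =>
    (hϑ.trans hlt).trans_le (hmono ⟨le_rfl, hτ0.le⟩ hs hs.1)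
  have hderiv : ∀ s ∈ Set.Icc 0 τ,
      HasDerivAt (fun s => (g s)⁻¹ + s * ϑ⁻¹) (-g' s / g s ^ 2 + ϑ⁻¹) s := fun s hs =>
    (((hg s (hmem s hs)).inv (hpos s hs).ne').add
      ((hasDerivAt_id s).mul_const ϑ⁻¹)).congr_deriv (by rw [one_mul])
  have hanti : AntitoneOn (fun s => (g s)⁻¹ + s * ϑ⁻¹) (Set.Icc 0 τ) := by
    refine antitoneOn_of_hasDerivWithinAt_nonpos (convex_Icc 0 τ)
      (fun s hs => (hderiv s hs).continuousAt.continuousWithinAt)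
      (fun s hs => (hderiv s (interior_subset hs)).hasDerivWithinAt) fun s hs => ?_
    have hquot : ϑ⁻¹ ≤ g' s / g s ^ 2 := by
      rw [le_div_iff₀ (pow_pos (hpos s (interior_subset hs)) 2), inv_mul_le_iff₀ hϑ]
      exact hle s (hmem' s hs)
    rw [neg_div]
    linarith
  have hend := hanti ⟨le_rfl, hτ0.le⟩ ⟨hτ0.le, le_rfl⟩ hτ0.le
  have hτϑ : τ * ϑ⁻¹ = (g 0)⁻¹ := by rw [div_mul_eq_mul_div, mul_inv_cancel₀ hϑ.ne', one_div]
  simp only [hτϑ, zero_mul, add_zero] at hend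
  linarith [inv_pos.2 (hpos τ ⟨hτ0.le, le_rfl⟩)]

section HessianForm

variable {E : Type*} [NormedAddCommGroup E] [NormedSpace ℝ E] {f : E → ℝ} {V : Submodule ℝ E}
  {x : E} {r r' : ℝ}

/-- The Hessian of `f` at `x` as a bilinear form. -/
noncomputable def hessForm (f : E → ℝ) (x : E) : LinearMap.BilinForm ℝ E :=
  (fderiv ℝ (fderiv ℝ f) x).toBilinForm

theorem hessForm_apply (v w : E) : hessForm f x v w = fderiv ℝ (fderiv ℝ f) x v w := rfl

/-- The local norm `‖v‖_{∇²f(x)}`. -/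
noncomputable def localNorm (f : E → ℝ) (x v : E) : ℝ := √(hessForm f x v v)

/-- The Newton decrement of `f` at `x`, restricted to the subspace `V` of directions, is at most
`r`. It is expressed through the dual of the local norm, so that no minimizer over `V` is needed. -/
def DecrementLE (f : E → ℝ) (V : Submodule ℝ E) (r : ℝ) (x : E) : Prop :=
  ∀ v ∈ V, fderiv ℝ f x v ≤ r * localNorm f x v

/-- `h` solves the Newton equation of `f` at `x` in the directions of `V`. The step `h` itself need
not lie in `V`: it may also correct a violated equality constraint. -/
def IsNewtonStep (f : E → ℝ) (V : Submodule ℝ E) (x h : E) : Prop :=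
  ∀ v ∈ V, fderiv ℝ f x v + hessForm f x h v = 0

theorem localNorm_nonneg (v : E) : 0 ≤ localNorm f x v := Real.sqrt_nonneg _

@[simp]
theorem localNorm_zero : localNorm f x 0 = 0 := by simp [localNorm]

@[simp]
theorem localNorm_neg (v : E) : localNorm f x (-v) = localNorm f x v := by simp [localNorm]

theorem localNorm_smul (a : ℝ) (v : E) : localNorm f x (a • v) = |a| * localNorm f x v := by
  rw [localNorm, localNorm, LinearMap.BilinForm.smul_left, LinearMap.BilinForm.smul_right,
    ← mul_assoc, Real.sqrt_mul (mul_self_nonneg a), Real.sqrt_mul_self_eq_abs]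

theorem continuous_localNorm : Continuous (localNorm f x) := by
  have h : Continuous fun v => fderiv ℝ (fderiv ℝ f) x v v := by fun_prop
  exact h.sqrt

theorem DecrementLE.mono (h : DecrementLE f V r x) (hr : r ≤ r') : DecrementLE f V r' x :=
  fun v hv => (h v hv).trans (mul_le_mul_of_nonneg_right hr (localNorm_nonneg v))

theorem DecrementLE.nonneg (h : DecrementLE f V r x) {v : E} (hv : v ∈ V)
    (hpos : 0 < localNorm f x v) : 0 ≤ r := by
  have hv₁ := h v hv
  have hv₂ := h (-v) (neg_mem hv)
  rw [map_neg, localNorm_neg] at hv₂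
  nlinarith

end HessianForm

section Euclidean

variable {n : ℕ} {f : Vec n → ℝ} {S : Set (Vec n)} {V : Submodule ℝ (Vec n)} {x y h u : Vec n}
  {r lam L vf : ℝ}

theorem dotProduct_hessian_mulVec (f : Vec n → ℝ) (x v w : Vec n) :
    v.ofLp ⬝ᵥ (hessian f x *ᵥ w.ofLp) = hessForm f x v w := by
  have hsum : ∀ u : Vec n, u = ∑ i, u i • EuclideanSpace.single i (1 : ℝ) := fun u => by
    simpa using ((EuclideanSpace.basisFun (Fin n) ℝ).sum_repr u).symm
  conv_rhs => rw [hsum v, hsum w]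
  simp only [dotProduct, mulVec, hessian, of_apply, Finset.mul_sum, map_sum,
    LinearMap.sum_apply, map_smul, LinearMap.smul_apply, smul_eq_mul, hessForm,
    ContinuousLinearMap.toBilinForm_apply]
  exact Finset.sum_comm.trans
    (Finset.sum_congr rfl fun i _ => Finset.sum_congr rfl fun j _ => by ring)

theorem matNorm_hessian (f : Vec n → ℝ) (x v : Vec n) :
    matNorm (hessian f x) v.ofLp = localNorm f x v := by
  rw [matNorm, localNorm, dotProduct_hessian_mulVec]

theorem dotProduct_gradient (f : Vec n → ℝ) (x v : Vec n) :
    v.ofLp ⬝ᵥ (gradient f x).ofLp = fderiv ℝ f x v := by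
  rw [← inner_gradient_left, EuclideanSpace.inner_eq_star_dotProduct, star_trivial]

namespace IsSelfConcordantOn

variable (hf : IsSelfConcordantOn f S)
include hf

theorem hessForm_pos (hx : x ∈ S) {v : Vec n} (hv : v ≠ 0) : 0 < hessForm f x v v := by
  rw [← dotProduct_hessian_mulVec]
  simpa using (hf.posDef x hx).dotProduct_mulVec_pos (x := v.ofLp) (by simpa using hv)

theorem hessForm_nonneg (hx : x ∈ S) (v : Vec n) : 0 ≤ hessForm f x v v := by
  rcases eq_or_ne v 0 with rfl | hv
  · simp
  · exact (hf.hessForm_pos hx hv).le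

theorem isSymm_hessForm (hx : x ∈ S) : (hessForm f x).IsSymm := by
  rw [LinearMap.BilinForm.isSymm_def]
  intro v w
  have hsymm : (hessian f x)ᵀ = hessian f x := by
    simpa only [IsHermitian, conjTranspose_eq_transpose_of_trivial] using (hf.posDef x hx).1
  rw [← dotProduct_hessian_mulVec, ← dotProduct_hessian_mulVec, dotProduct_mulVec,
    ← mulVec_transpose, hsymm, dotProduct_comm]

theorem hessForm_comm (hx : x ∈ S) (v w : Vec n) : hessForm f x v w = hessForm f x w v :=
  LinearMap.BilinForm.isSymm_def.1 (hf.isSymm_hessForm hx) v w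

theorem localNorm_sq (hx : x ∈ S) (v : Vec n) : localNorm f x v ^ 2 = hessForm f x v v :=
  Real.sq_sqrt (hf.hessForm_nonneg hx v)

theorem localNorm_pos (hx : x ∈ S) {v : Vec n} (hv : v ≠ 0) : 0 < localNorm f x v :=
  Real.sqrt_pos.2 (hf.hessForm_pos hx hv)

theorem abs_hessForm_le_mul (hx : x ∈ S) (v w : Vec n) :
    |hessForm f x v w| ≤ localNorm f x v * localNorm f x w :=
  abs_bilin_le_sqrt_mul_sqrt (hf.isSymm_hessForm hx)
    (fun u => (abs_of_nonneg (hf.hessForm_nonneg hx u)).le) v w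

theorem exists_mul_norm_le_localNorm (hx : x ∈ S) :
    ∃ κ : ℝ, 0 < κ ∧ ∀ v, κ * ‖v‖ ≤ localNorm f x v := by
  obtain ⟨κ, hκ, hsphere⟩ := (isCompact_sphere (0 : Vec n) 1).exists_forall_le'
    continuous_localNorm.continuousOn fun v hv =>
      hf.localNorm_pos hx (ne_zero_of_mem_unit_sphere ⟨v, hv⟩)
  refine ⟨κ, hκ, fun v => ?_⟩
  rcases eq_or_ne v 0 with rfl | hv
  · simp
  have hunit := hsphere (‖v‖⁻¹ • v) (by simp [norm_smul, hv])
  rw [localNorm_smul, abs_of_nonneg (by positivity)] at hunit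
  rwa [← le_inv_mul_iff₀' (norm_pos_iff.2 hv)]

theorem mem_of_localNorm_lt (hx : x ∈ S) (hy : localNorm f x (y - x) < 1) : y ∈ S :=
  hf.ball_subset x hx y (by rwa [matNorm_hessian])

theorem add_mem (hx : x ∈ S) (hh : localNorm f x h < 1) : x + h ∈ S :=
  hf.mem_of_localNorm_lt hx (by rwa [add_sub_cancel_left])

theorem isOpen : IsOpen S := by
  refine isOpen_iff_mem_nhds.2 fun x hx => ?_
  have hcont : Continuous fun y => localNorm f x (y - x) :=
    continuous_localNorm.comp (continuous_id.sub continuous_const)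
  filter_upwards [hcont.continuousAt.eventually_lt continuousAt_const
    (by simp : localNorm f x (x - x) < 1)] with y hy
  exact hf.mem_of_localNorm_lt hx hy

theorem contDiffAt (hx : x ∈ S) : ContDiffAt ℝ 2 f x :=
  hf.contDiffOn.contDiffAt (hf.isOpen.mem_nhds hx)

theorem differentiableAt (hx : x ∈ S) : DifferentiableAt ℝ f x :=
  (hf.contDiffAt hx).differentiableAt (by norm_num)

theorem hasDerivAt_fderiv_line (x v w : Vec n) {s : ℝ} (hs : x + s • v ∈ S) :
    HasDerivAt (fun s : ℝ => fderiv ℝ f (x + s • v) w) (hessForm f (x + s • v) v w) s := by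
  have hline : HasDerivAt (fun s : ℝ => x + s • v) v s := by
    simpa using ((hasDerivAt_id s).smul_const v).const_add x
  have hfderiv : DifferentiableAt ℝ (fderiv ℝ f) (x + s • v) :=
    ((hf.contDiffAt hs).fderiv_right (m := 1) (by norm_num)).differentiableAt (by norm_num)
  have hcomp := hfderiv.hasFDerivAt.comp_hasDerivAt s hline
  exact (hcomp.clm_apply (hasDerivAt_const s w)).congr_deriv (by simp [hessForm_apply])

theorem one_sub_mul_localNorm_le (hx : x ∈ S) (hy : localNorm f x (y - x) < 1) (v : Vec n) :
    (1 - localNorm f x (y - x)) * localNorm f y v ≤ localNorm f x v := by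
  rcases eq_or_ne v 0 with rfl | hv
  · simp
  have hratio := hf.ratio_le x hx y (by rwa [matNorm_hessian]) v hv
  simp only [matNorm_hessian] at hratio
  rw [div_le_div_iff₀ (hf.localNorm_pos hx hv) (by linarith)] at hratio
  linarith

/- Exchange the two points in the comparison above: `‖x - y‖_y ≤ r / (1 - r) < 1`. -/
theorem one_sub_two_mul_localNorm_le (hx : x ∈ S) (hy : localNorm f x (y - x) < 1 / 2)
    (v : Vec n) : (1 - 2 * localNorm f x (y - x)) * localNorm f x v
      ≤ (1 - localNorm f x (y - x)) * localNorm f y v := by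
  have hyS : y ∈ S := hf.mem_of_localNorm_lt hx (by linarith)
  have hback : (1 - localNorm f x (y - x)) * localNorm f y (x - y) ≤ localNorm f x (y - x) := by
    rw [← neg_sub y x, localNorm_neg]
    exact hf.one_sub_mul_localNorm_le hx (by linarith) (y - x)
  have hcmp := hf.one_sub_mul_localNorm_le hyS (by nlinarith) v
  nlinarith [localNorm_nonneg (f := f) (x := x) v]

theorem abs_hessForm_sub_self_le (hx : x ∈ S) (hy : localNorm f x (y - x) < 1) (v : Vec n) :
    |hessForm f y v v - hessForm f x v v|
      ≤ (1 / (1 - localNorm f x (y - x)) ^ 2 - 1) * hessForm f x v v := by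
  have hyS : y ∈ S := hf.mem_of_localNorm_lt hx hy
  have hupper := hf.one_sub_mul_localNorm_le hx hy v
  have hlower := fun hy' => hf.one_sub_two_mul_localNorm_le hx (y := y) hy' v
  have ha := localNorm_nonneg (f := f) (x := x) v
  have hb := localNorm_nonneg (f := f) (x := y) v
  have hr := localNorm_nonneg (f := f) (x := x) (y - x)
  rw [← hf.localNorm_sq hx, ← hf.localNorm_sq hyS]
  generalize localNorm f x v = a, localNorm f y v = b, localNorm f x (y - x) = r at *
  have hb_le : ((1 - r) * b) ^ 2 ≤ a ^ 2 := pow_le_pow_left₀ (by nlinarith) hupper 2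
  have hle_b : (2 * (1 - r) ^ 2 - 1) * a ^ 2 ≤ ((1 - r) * b) ^ 2 := by
    rcases lt_or_ge r (1 / 2) with hr' | hr'
    · have hsq := pow_le_pow_left₀ (by nlinarith) (hlower hr') 2
      nlinarith [mul_nonneg (sq_nonneg r) (sq_nonneg a)]
    · have hcoef : 2 * (1 - r) ^ 2 - 1 ≤ 0 := by nlinarith
      exact (mul_nonpos_of_nonpos_of_nonneg hcoef (sq_nonneg a)).trans (sq_nonneg _)
  have hpos : 0 < (1 - r) ^ 2 := by nlinarith
  rw [div_sub_one hpos.ne', div_mul_eq_mul_div, abs_le, ← neg_div, div_le_iff₀ hpos,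
    le_div_iff₀ hpos]
  constructor <;> linarith

theorem abs_hessForm_sub_le (hx : x ∈ S) (hy : localNorm f x (y - x) < 1) (v w : Vec n) :
    |hessForm f y v w - hessForm f x v w|
      ≤ (1 / (1 - localNorm f x (y - x)) ^ 2 - 1) * (localNorm f x v * localNorm f x w) := by
  have hyS : y ∈ S := hf.mem_of_localNorm_lt hx hy
  have hc : 0 ≤ 1 / (1 - localNorm f x (y - x)) ^ 2 - 1 := by
    rw [sub_nonneg]
    exact one_le_one_div (by nlinarith) (pow_le_one₀ (by linarith)
      (by linarith [localNorm_nonneg (f := f) (x := x) (y - x)]))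
  have hbound := abs_bilin_le_sqrt_mul_sqrt (B := hessForm f y - hessForm f x)
    (Q := (1 / (1 - localNorm f x (y - x)) ^ 2 - 1) • hessForm f x)
    ((hf.isSymm_hessForm hyS).sub (hf.isSymm_hessForm hx))
    (hf.abs_hessForm_sub_self_le hx hy) v w
  simp only [LinearMap.sub_apply, LinearMap.smul_apply, smul_eq_mul, Real.sqrt_mul hc] at hbound
  rwa [mul_mul_mul_comm, Real.mul_self_sqrt hc] at hbound

theorem abs_fderiv_add_sub_le (hx : x ∈ S) (hh : localNorm f x h < 1) (v : Vec n) :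
    |fderiv ℝ f (x + h) v - fderiv ℝ f x v - hessForm f x h v|
      ≤ localNorm f x h ^ 2 / (1 - localNorm f x h) * localNorm f x v := by
  set r := localNorm f x h
  have hr0 : 0 ≤ r := localNorm_nonneg h
  have hsr : ∀ s ∈ Set.Icc (0 : ℝ) 1, s * r < 1 := fun s hs => by nlinarith [hs.1, hs.2]
  have hstep : ∀ s ∈ Set.Icc (0 : ℝ) 1, localNorm f x (x + s • h - x) = s * r := fun s hs => by
    rw [add_sub_cancel_left, localNorm_smul, abs_of_nonneg hs.1]
  have hderiv : ∀ s ∈ Set.Icc (0 : ℝ) 1, HasDerivAt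
      (fun s : ℝ => fderiv ℝ f (x + s • h) v - fderiv ℝ f x v - s * hessForm f x h v)
      (hessForm f (x + s • h) h v - hessForm f x h v) s := fun s hs => by
    have hmem := hf.mem_of_localNorm_lt hx ((hstep s hs).trans_lt (hsr s hs))
    exact (((hf.hasDerivAt_fderiv_line x h v hmem).sub_const (fderiv ℝ f x v)).sub
      ((hasDerivAt_id s).mul_const (hessForm f x h v))).congr_deriv (by simp)
  have hboundary : ∀ s ∈ Set.Icc (0 : ℝ) 1, HasDerivAt
      (fun s : ℝ => ((1 - s * r)⁻¹ - 1 - s * r) * localNorm f x v)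
      ((1 / (1 - s * r) ^ 2 - 1) * (r * localNorm f x v)) s := fun s hs => by
    have hne : 1 - s * r ≠ 0 := by linarith [hsr s hs]
    have hlin : HasDerivAt (fun s : ℝ => s * r) r s := by
      simpa using (hasDerivAt_id s).mul_const r
    refine (((((hlin.const_sub 1).inv hne).sub_const 1).sub hlin).mul_const
      (localNorm f x v)).congr_deriv ?_
    field_simp
  have hfinal := image_norm_le_of_norm_deriv_right_le_deriv_boundary'
    (fun s hs => (hderiv s hs).continuousAt.continuousWithinAt)
    (fun s hs => (hderiv s ⟨hs.1, hs.2.le⟩).hasDerivWithinAt) (by simp)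
    (fun s hs => (hboundary s hs).continuousAt.continuousWithinAt)
    (fun s hs => (hboundary s ⟨hs.1, hs.2.le⟩).hasDerivWithinAt)
    (fun s hs => by
      have hs' : s ∈ Set.Icc (0 : ℝ) 1 := ⟨hs.1, hs.2.le⟩
      have := hf.abs_hessForm_sub_le hx ((hstep s hs').trans_lt (hsr s hs')) h v
      rwa [hstep s hs'] at this) (Set.right_mem_Icc.2 zero_le_one)
  have hr1 : 1 - r ≠ 0 := by linarith
  convert hfinal using 1
  · simp
  · field_simp
    ring

theorem decrementLE_of_isNewtonStep (hx : x ∈ S) (hh : IsNewtonStep f V x h) :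
    DecrementLE f V (localNorm f x h) x := fun v hv => by
  linarith [hh v hv, (abs_le.1 (hf.abs_hessForm_le_mul hx h v)).1]

theorem decrementLE_add_of_isNewtonStep (hx : x ∈ S) (hh : IsNewtonStep f V x h)
    (hr : localNorm f x h < 1 / 2) :
    DecrementLE f V (localNorm f x h ^ 2 / (1 - 2 * localNorm f x h)) (x + h) := by
  intro v hv
  have htaylor := (abs_le.1 (hf.abs_fderiv_add_sub_le hx (by linarith) v)).2
  have hcmp := hf.one_sub_two_mul_localNorm_le (y := x + h) hx (by rwa [add_sub_cancel_left]) v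
  rw [add_sub_cancel_left] at hcmp
  calc fderiv ℝ f (x + h) v
      ≤ localNorm f x h ^ 2 / (1 - localNorm f x h) * localNorm f x v := by linarith [hh v hv]
    _ ≤ localNorm f x h ^ 2 / (1 - 2 * localNorm f x h) * localNorm f (x + h) v := by
      rw [div_mul_eq_mul_div, div_mul_eq_mul_div, div_le_div_iff₀ (by linarith) (by linarith)]
      nlinarith [mul_le_mul_of_nonneg_left hcmp (sq_nonneg (localNorm f x h))]

/- Pythagoras: `h` is the sum of `h - u`, a Newton step inside `V`, and of `u`, which is
orthogonal to `V`. -/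
theorem localNorm_sq_le_of_isNewtonStep (hx : x ∈ S) (hh : IsNewtonStep f V x h)
    (hlam : DecrementLE f V lam x) (hu : ∀ v ∈ V, hessForm f x u v = 0) (hhu : h - u ∈ V) :
    localNorm f x h ^ 2 ≤ lam ^ 2 + localNorm f x u ^ 2 := by
  obtain ⟨w, rfl⟩ : ∃ w, h = w + u := ⟨h - u, (sub_add_cancel h u).symm⟩
  rw [add_sub_cancel_right] at hhu
  have hpyth : localNorm f x (w + u) ^ 2 = localNorm f x w ^ 2 + localNorm f x u ^ 2 := by
    simp only [hf.localNorm_sq hx, map_add, LinearMap.add_apply, hu w hhu, hf.hessForm_comm hx w u]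
    ring
  have hstep := hh w hhu
  rw [map_add, LinearMap.add_apply, hu w hhu, ← hf.localNorm_sq hx] at hstep
  have hdec := hlam (-w) (neg_mem hhu)
  rw [map_neg, localNorm_neg] at hdec
  nlinarith [sq_nonneg (lam - localNorm f x w)]

theorem decrementLE_sqrt_of_complexity_le (hx : x ∈ S)
    (hc : (gradient f x).ofLp ⬝ᵥ ((hessian f x)⁻¹ *ᵥ (gradient f x).ofLp) ≤ vf) :
    DecrementLE f ⊤ (√vf) x := by
  set w : Vec n := WithLp.toLp 2 ((hessian f x)⁻¹ *ᵥ (gradient f x).ofLp) with hw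
  have hHw : hessian f x *ᵥ w.ofLp = (gradient f x).ofLp := by
    rw [hw, mulVec_mulVec, mul_nonsing_inv _ (hf.posDef x hx).det_pos.ne'.isUnit, one_mulVec]
  have hform : ∀ v, hessForm f x v w = fderiv ℝ f x v := fun v => by
    rw [← dotProduct_hessian_mulVec, hHw, dotProduct_gradient]
  have hstep : IsNewtonStep f ⊤ x (-w) := fun v _ => by
    rw [hf.hessForm_comm hx, map_neg, hform, add_neg_cancel]
  have hnorm : localNorm f x (-w) ≤ √vf := by
    rw [localNorm_neg, localNorm, hform, ← dotProduct_gradient, dotProduct_comm]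
    exact Real.sqrt_le_sqrt hc
  exact (hf.decrementLE_of_isNewtonStep hx hstep).mono hnorm

theorem le_fderiv_add_smul (hx : x ∈ S) (v : Vec n) {s : ℝ} (hs : 0 ≤ s)
    (hr : s * localNorm f x v = r) (hr1 : r < 1) :
    fderiv ℝ f x v + (r - r ^ 2 / (1 - r)) * localNorm f x v ≤ fderiv ℝ f (x + s • v) v := by
  have hnorm : localNorm f x (s • v) = r := by rw [localNorm_smul, abs_of_nonneg hs, hr]
  have htaylor := (abs_le.1 (hf.abs_fderiv_add_sub_le hx (hnorm.trans_lt hr1) v)).1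
  rw [hnorm, map_smul, LinearMap.smul_apply, smul_eq_mul, ← hf.localNorm_sq hx] at htaylor
  linear_combination htaylor - localNorm f x v * hr

theorem decrementLE_improve (hL : ∀ x ∈ S, DecrementLE f ⊤ L x) (hx : x ∈ S) (hr : 0 < r)
    (hr1 : r < 1) : DecrementLE f ⊤ ((L + r ^ 2) / (1 - r) - r) x := by
  intro v _
  rcases eq_or_ne v 0 with rfl | hv
  · simp
  have hpos := hf.localNorm_pos hx hv
  have hL0 : 0 ≤ L := (hL x hx).nonneg trivial hpos
  have hs : 0 ≤ r / localNorm f x v := by positivity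
  have hsr : r / localNorm f x v * localNorm f x v = r := div_mul_cancel₀ r hpos.ne'
  have hdist : localNorm f x (x + (r / localNorm f x v) • v - x) = r := by
    rw [add_sub_cancel_left, localNorm_smul, abs_of_nonneg hs, hsr]
  have hgrow := hf.le_fderiv_add_smul hx v hs hsr hr1
  have hbound := hL _ (hf.mem_of_localNorm_lt hx (hdist.trans_lt hr1)) v trivial
  have hcmp := hf.one_sub_mul_localNorm_le hx (hdist.trans_lt hr1) v
  rw [hdist, ← le_div_iff₀' (by linarith)] at hcmp
  have := mul_le_mul_of_nonneg_left hcmp hL0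
  linear_combination this + hbound + hgrow

/- Improving the infimum `m` of all bounds gives `1 - 2 r ≤ m` for every small radius `r`. -/
theorem one_le_of_decrementLE (hS : S.Nonempty) (hn : 0 < n)
    (hL : ∀ x ∈ S, DecrementLE f ⊤ L x) : 1 ≤ L := by
  set B : Set ℝ := {M | ∀ x ∈ S, DecrementLE f ⊤ M x}
  have hnonneg : ∀ M ∈ B, 0 ≤ M := fun M hM => by
    obtain ⟨x, hx⟩ := hS
    have hv : (EuclideanSpace.single ⟨0, hn⟩ 1 : Vec n) ≠ 0 := by simp
    exact (hM x hx).nonneg trivial (hf.localNorm_pos hx hv)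
  have hinf : ∀ M ∈ B, sInf B ≤ M := fun M hM => csInf_le ⟨0, hnonneg⟩ hM
  refine le_trans ?_ (hinf L hL)
  refine le_of_forall_pos_le_add fun ε hε => ?_
  obtain ⟨r, hr, hrε⟩ := exists_between (lt_min one_pos (half_pos hε))
  obtain ⟨hr1, hrε⟩ := lt_min_iff.1 hrε
  have himp : (1 - r) * (sInf B + r) - r ^ 2 ≤ sInf B := le_csInf ⟨L, hL⟩ fun M hM => by
    have := hinf _ fun x hx => hf.decrementLE_improve hM hx hr hr1
    rw [le_sub_iff_add_le, le_div_iff₀' (by linarith)] at this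
    linarith
  nlinarith

theorem fderiv_segment_le (hL0 : 0 < L) (hL : ∀ x ∈ S, DecrementLE f ⊤ L x)
    (hseg : ∀ s ∈ Set.Ico (0 : ℝ) 1, x + s • h ∈ S) : fderiv ℝ f x h ≤ L ^ 2 := by
  have hmono : ∀ s ∈ Set.Ico (0 : ℝ) 1,
      fderiv ℝ f (x + s • h) h ^ 2 ≤ L ^ 2 * hessForm f (x + s • h) h h := fun s hs => by
    have hle := hL _ (hseg s hs) h trivial
    have hge := hL _ (hseg s hs) (-h) trivial
    rw [map_neg, localNorm_neg] at hge
    rw [← hf.localNorm_sq (hseg s hs), ← mul_pow]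
    exact sq_le_sq' (by linarith) hle
  simpa using le_of_sq_le_mul_deriv (by positivity)
    (fun s hs => hf.hasDerivAt_fderiv_line x h h (hseg s hs)) hmono

/- Moving a local distance `1 / 4` along the segment gains `‖h‖_x / 6` in the derivative. -/
theorem fderiv_segment_le_sub (hL1 : 1 ≤ L) (hL : ∀ x ∈ S, DecrementLE f ⊤ L x)
    (hseg : ∀ s ∈ Set.Ico (0 : ℝ) 1, x + s • h ∈ S) :
    fderiv ℝ f x h ≤ 4 / 3 * L ^ 2 - localNorm f x h / 6 := by
  have hx : x ∈ S := by simpa using hseg 0 (by simp)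
  rcases le_or_gt (localNorm f x h) 1 with hr | hr
  · nlinarith [hf.fderiv_segment_le (by linarith) hL hseg]
  set s := 1 / 4 / localNorm f x h
  have hs : 0 < s := by positivity
  have hsr : s * localNorm f x h = 1 / 4 := div_mul_cancel₀ _ (by positivity)
  have hs4 : s ≤ 1 / 4 := by nlinarith
  have hgrow := hf.le_fderiv_add_smul hx h hs.le hsr (by norm_num)
  have hrest := hf.fderiv_segment_le (x := x + s • h) (h := (1 - s) • h) (by linarith) hL
    fun t ht => by
      rw [smul_smul, add_assoc, ← add_smul]
      exact hseg _ ⟨by nlinarith [ht.1], by nlinarith [ht.2]⟩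
  rw [map_smul, smul_eq_mul] at hrest
  have : fderiv ℝ f (x + s • h) h ≤ 4 / 3 * L ^ 2 := by
    by_contra! hcon
    nlinarith [sq_nonneg L]
  linarith

theorem fderiv_clm_add (hx : x ∈ S) (ℓ : Vec n →L[ℝ] ℝ) :
    fderiv ℝ (fun y => ℓ y + f y) x = ℓ + fderiv ℝ f x := by
  rw [fderiv_fun_add ℓ.differentiableAt (hf.differentiableAt hx), ℓ.fderiv]

theorem fderiv_fderiv_clm_add (hx : x ∈ S) (ℓ : Vec n →L[ℝ] ℝ) :
    fderiv ℝ (fderiv ℝ fun y => ℓ y + f y) x = fderiv ℝ (fderiv ℝ f) x := by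
  have heq : fderiv ℝ (fun y => ℓ y + f y) =ᶠ[nhds x] fun y => ℓ + fderiv ℝ f y := by
    filter_upwards [hf.isOpen.mem_nhds hx] with y hy using hf.fderiv_clm_add hy ℓ
  rw [heq.fderiv_eq, fderiv_const_add]

theorem clm_add (ℓ : Vec n →L[ℝ] ℝ) : IsSelfConcordantOn (fun y => ℓ y + f y) S := by
  have hhess : ∀ x ∈ S, hessian (fun y => ℓ y + f y) x = hessian f x := fun x hx => by
    simp only [hessian, hf.fderiv_fderiv_clm_add hx]
  refine ⟨ℓ.contDiff.contDiffOn.add hf.contDiffOn, fun x hx => ?_, fun x hx y hy => ?_,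
    fun x hx y hy v hv => ?_⟩
  · exact hhess x hx ▸ hf.posDef x hx
  · exact hf.ball_subset x hx y (hhess x hx ▸ hy)
  · rw [hhess x hx] at hy ⊢
    rw [hhess y (hf.ball_subset x hx y hy)]
    exact hf.ratio_le x hx y hy v hv

end IsSelfConcordantOn

end Euclidean

section KKT

theorem vecMul_injective_of_rank_eq {m n : Type*} [Fintype m] [Fintype n] {A : Matrix m n ℝ}
    (hA : A.rank = Fintype.card m) : Function.Injective A.vecMul := by
  rw [vecMul_injective_iff, linearIndependent_iff_card_eq_finrank_span, ← hA,
    rank_eq_finrank_span_row, Set.finrank]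

theorem isUnit_fromBlocks_transpose_zero {m n : Type*} [Fintype m] [Fintype n] [DecidableEq m]
    [DecidableEq n] {H : Matrix n n ℝ} {A : Matrix m n ℝ} (hH : H.PosDef)
    (hA : Function.Injective A.vecMul) : IsUnit (fromBlocks H Aᵀ A 0) := by
  have := hH.isUnit.invertible
  rw [isUnit_fromBlocks_iff_of_invertible₁₁, zero_sub, IsUnit.neg_iff, invOf_eq_nonsing_inv,
    ← conjTranspose_eq_transpose_of_trivial]
  exact (hH.inv.mul_mul_conjTranspose_same hA).isUnit

variable {n p : ℕ} {f : Vec n → ℝ} {S : Set (Vec n)} {A : Matrix (Fin p) (Fin n) ℝ} {x : Vec n}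
  {Δ : Fin n ⊕ Fin p → ℝ} {lam : ℝ}

/-- The KKT matrix `[∇²f(x), Aᵀ; A, 0]` of the minimization of `f` under `A x = b`. -/
noncomputable def kktMatrix (f : Vec n → ℝ) (A : Matrix (Fin p) (Fin n) ℝ) (x : Vec n) :
    Matrix (Fin n ⊕ Fin p) (Fin n ⊕ Fin p) ℝ :=
  fromBlocks (hessian f x) Aᵀ A 0

/-- The kernel of `A`, as a subspace of Euclidean space: the directions along which the equality
constraints are preserved. -/
noncomputable def kernel (A : Matrix (Fin p) (Fin n) ℝ) : Submodule ℝ (Vec n) :=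
  LinearMap.ker (Matrix.toEuclideanLin A)

/-- The primal part of a primal-dual displacement. -/
def primal (Δ : Fin n ⊕ Fin p → ℝ) : Vec n := WithLp.toLp 2 (Δ ∘ Sum.inl)

theorem mulV_add (u v : Vec n) : mulV A (u + v) = mulV A u + mulV A v :=
  map_add (Matrix.toEuclideanLin A) u v

theorem mulV_neg (v : Vec n) : mulV A (-v) = -mulV A v := map_neg (Matrix.toEuclideanLin A) v

theorem mulV_sub (u v : Vec n) : mulV A (u - v) = mulV A u - mulV A v :=
  map_sub (Matrix.toEuclideanLin A) u v

theorem mem_kernel {v : Vec n} : v ∈ kernel A ↔ mulV A v = 0 := Iff.rfl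

theorem primal_neg (Δ : Fin n ⊕ Fin p → ℝ) : primal (-Δ) = -primal Δ := rfl

theorem dotProduct_transpose_mulVec (v : Vec n) (w : Fin p → ℝ) :
    v.ofLp ⬝ᵥ (Aᵀ *ᵥ w) = (mulV A v).ofLp ⬝ᵥ w := by
  rw [dotProduct_mulVec, vecMul_transpose, mulV]

theorem kktMatrix_mulVec (f : Vec n → ℝ) (x : Vec n) (Δ : Fin n ⊕ Fin p → ℝ) :
    kktMatrix f A x *ᵥ Δ = Sum.elim
      (hessian f x *ᵥ (primal Δ).ofLp + Aᵀ *ᵥ (Δ ∘ Sum.inr)) (mulV A (primal Δ)).ofLp := by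
  rw [kktMatrix, fromBlocks_mulVec, zero_mulVec, add_zero, primal, mulV]

theorem matNorm_kktMatrix (hΔ : mulV A (primal Δ) = 0) :
    matNorm (kktMatrix f A x) Δ = localNorm f x (primal Δ) := by
  rw [matNorm, localNorm, kktMatrix_mulVec, ← Sum.elim_comp_inl_inr Δ,
    sumElim_dotProduct_sumElim, Sum.elim_comp_inl_inr, hΔ, ← dotProduct_hessian_mulVec]
  change √((primal Δ).ofLp ⬝ᵥ _ + _) = _
  rw [dotProduct_add, dotProduct_transpose_mulVec, hΔ]
  simp

section Solution

variable (hK : IsUnit (kktMatrix f A x))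
include hK

theorem kktMatrix_mulVec_inv_mulVec (R : Fin n ⊕ Fin p → ℝ) :
    kktMatrix f A x *ᵥ ((kktMatrix f A x)⁻¹ *ᵥ R) = R := by
  rw [mulVec_mulVec, mul_nonsing_inv _ ((isUnit_iff_isUnit_det _).1 hK), one_mulVec]

theorem mulV_primal_inv_mulVec (R : Fin n ⊕ Fin p → ℝ) :
    (mulV A (primal ((kktMatrix f A x)⁻¹ *ᵥ R))).ofLp = R ∘ Sum.inr := by
  conv_rhs => rw [← kktMatrix_mulVec_inv_mulVec hK R, kktMatrix_mulVec]
  rfl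

theorem hessForm_primal_inv_mulVec (R : Fin n ⊕ Fin p → ℝ) (v : Vec n) :
    hessForm f x v (primal ((kktMatrix f A x)⁻¹ *ᵥ R))
      + (mulV A v).ofLp ⬝ᵥ (((kktMatrix f A x)⁻¹ *ᵥ R) ∘ Sum.inr) = v.ofLp ⬝ᵥ (R ∘ Sum.inl) := by
  conv_rhs => rw [← kktMatrix_mulVec_inv_mulVec hK R, kktMatrix_mulVec]
  rw [Sum.elim_comp_inl, dotProduct_add, dotProduct_hessian_mulVec, dotProduct_transpose_mulVec]

end Solution

namespace IsSelfConcordantOn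

variable (hf : IsSelfConcordantOn f S)
include hf

theorem isUnit_kktMatrix (hA : Function.Injective A.vecMul) (hx : x ∈ S) :
    IsUnit (kktMatrix f A x) :=
  isUnit_fromBlocks_transpose_zero (hf.posDef x hx) hA

theorem isNewtonStep_kkt (hK : IsUnit (kktMatrix f A x)) (hx : x ∈ S) (ν : Vec p)
    (ρ : Fin p → ℝ) :
    IsNewtonStep f (kernel A) x (primal (-((kktMatrix f A x)⁻¹ *ᵥ
      Sum.elim ((gradient f x).ofLp + Aᵀ *ᵥ ν.ofLp) ρ))) := by
  intro v hv
  have hsol := hessForm_primal_inv_mulVec hK (Sum.elim ((gradient f x).ofLp + Aᵀ *ᵥ ν.ofLp) ρ) v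
  rw [Sum.elim_comp_inl, dotProduct_add, dotProduct_gradient, dotProduct_transpose_mulVec,
    mem_kernel.1 hv, WithLp.ofLp_zero, zero_dotProduct, zero_dotProduct, add_zero,
    add_zero] at hsol
  rw [hf.hessForm_comm hx, primal_neg, map_neg, hsol, add_neg_cancel]

/- `u` is the displacement with `A u = δ` of least local norm; by the KKT system,
`‖u‖²_x = -⟪R, D⁻¹ R⟫` for `R = (0, δ)`. -/
theorem exists_mulV_eq_localNorm_sq_le (hK : IsUnit (kktMatrix f A x)) (hx : x ∈ S) (δ : Vec p) :
    ∃ u, mulV A u = δ ∧ (∀ v ∈ kernel A, hessForm f x u v = 0) ∧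
      localNorm f x u ^ 2
        ≤ ‖Matrix.toEuclideanCLM (n := Fin n ⊕ Fin p) (𝕜 := ℝ) (kktMatrix f A x)⁻¹‖
          * ‖δ‖ ^ 2 := by
  set R : Fin n ⊕ Fin p → ℝ := Sum.elim 0 δ.ofLp
  set z := (kktMatrix f A x)⁻¹ *ᵥ R with hz
  have hsol : ∀ v, hessForm f x v (primal z) + (mulV A v).ofLp ⬝ᵥ (z ∘ Sum.inr) = 0 := fun v => by
    rw [hessForm_primal_inv_mulVec hK, Sum.elim_comp_inl, dotProduct_zero]
  have hAu : mulV A (primal z) = δ := WithLp.ofLp_injective 2 (mulV_primal_inv_mulVec hK R)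
  refine ⟨primal z, hAu, fun v hv => ?_, ?_⟩
  · simpa [mem_kernel.1 hv, hf.hessForm_comm hx v] using hsol v
  have hRz : R ⬝ᵥ z = δ.ofLp ⬝ᵥ (z ∘ Sum.inr) := by
    rw [← Sum.elim_comp_inl_inr z, sumElim_dotProduct_sumElim, zero_dotProduct, zero_add,
      Sum.elim_comp_inr]
  have hRnorm : ‖WithLp.toLp 2 R‖ = ‖δ‖ := by
    simp [EuclideanSpace.norm_eq, R]
  calc localNorm f x (primal z) ^ 2
      = -inner ℝ (WithLp.toLp 2 R) (WithLp.toLp 2 z) := by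
        rw [hf.localNorm_sq hx, EuclideanSpace.inner_toLp_toLp, star_trivial, dotProduct_comm, hRz,
          ← hAu]
        linarith [hsol (primal z)]
    _ ≤ ‖WithLp.toLp 2 R‖ * ‖WithLp.toLp 2 z‖ :=
        (neg_le_abs _).trans (abs_real_inner_le_norm _ _)
    _ ≤ ‖WithLp.toLp 2 R‖ * (‖Matrix.toEuclideanCLM (n := Fin n ⊕ Fin p) (𝕜 := ℝ)
          (kktMatrix f A x)⁻¹‖ * ‖WithLp.toLp 2 R‖) := by
        gcongr
        rw [hz, ← Matrix.toEuclideanCLM_toLp]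
        exact ContinuousLinearMap.le_opNorm _ _
    _ = _ := by rw [hRnorm]; ring

theorem localNorm_sq_le_of_isNewtonStep_kernel (hK : IsUnit (kktMatrix f A x)) (hx : x ∈ S)
    {h : Vec n} (hh : IsNewtonStep f (kernel A) x h) (hlam : DecrementLE f (kernel A) lam x) :
    localNorm f x h ^ 2 ≤ lam ^ 2
      + ‖Matrix.toEuclideanCLM (n := Fin n ⊕ Fin p) (𝕜 := ℝ) (kktMatrix f A x)⁻¹‖
        * ‖mulV A h‖ ^ 2 := by
  obtain ⟨u, hAu, horth, hu⟩ := hf.exists_mulV_eq_localNorm_sq_le hK hx (mulV A h)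
  have hmem : h - u ∈ kernel A := by rw [mem_kernel, mulV_sub, hAu, sub_self]
  linarith [hf.localNorm_sq_le_of_isNewtonStep hx hh hlam horth hmem]

end IsSelfConcordantOn

end KKT

theorem abs_sub_le_mul_hausdorffDist {X : Type*} [PseudoMetricSpace X] {F : X → ℝ} {K : NNReal}
    (hF : LipschitzWith K F) {s t : Set X} {x y : X} (hx : x ∈ s) (hy : y ∈ t)
    (hconst : ∀ z ∈ t, F z = F y) (hs : Bornology.IsBounded s) (ht : Bornology.IsBounded t) :
    |F x - F y| ≤ K * Metric.hausdorffDist s t := by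
  have : Nonempty t := ⟨⟨y, hy⟩⟩
  calc |F x - F y|
      ≤ ⨅ z : t, K * dist x z :=
        le_ciInf fun z => by simpa only [← hconst z z.2, Real.dist_eq] using hF.dist_le_mul x z
    _ = K * Metric.infDist x t := by
        rw [Metric.infDist_eq_iInf, Real.mul_iInf_of_nonneg K.coe_nonneg]
    _ ≤ K * Metric.hausdorffDist s t := by
        gcongr
        exact Metric.infDist_le_hausdorffDist_of_mem hx
          (Metric.hausdorffEDist_ne_top_of_nonempty_of_bounded ⟨x, hx⟩ ⟨y, hy⟩ hs ht)

theorem isBigO_add_one_of_abs_le {α : Type*} {l : Filter α} {u w : α → ℝ} {C K : ℝ}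
    (hw : ∀ a, 0 ≤ w a) (h : ∀ a, |u a| ≤ C + K * w a) : u =O[l] fun a => w a + 1 := by
  refine IsBigO.of_bound (|C| + |K|) (Eventually.of_forall fun a => (h a).trans ?_)
  rw [Real.norm_of_nonneg (by linarith [hw a])]
  nlinarith [hw a, le_abs_self C, le_abs_self K, abs_nonneg C, abs_nonneg K,
    mul_le_mul_of_nonneg_right (le_abs_self K) (hw a), mul_nonneg (abs_nonneg C) (hw a)]

namespace Problem

variable {N P I : ℕ} {pb : Problem N P I} {x y : Vec N} {η lam r L vf m β η₀ : ℝ} {s t T : ℕ}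

open scoped Pointwise in
theorem add_smul_sub_mem_dom (hx : x ∈ pb.dom) (hy : ∀ i, y ∈ pb.ineqSet i) {a : ℝ}
    (ha : a ∈ Set.Ico (0 : ℝ) 1) : x + a • (y - x) ∈ pb.dom := by
  intro i
  have hadd : interior (pb.K i : Set (Vec (pb.q i))) + (pb.K i : Set (Vec (pb.q i)))
      ⊆ interior (pb.K i) := by
    refine interior_maximal ?_ isOpen_interior.add_right
    rintro _ ⟨u, hu, v, hv, rfl⟩
    exact (pb.K i).add_mem (interior_subset hu) hv
  have hcombo := (pb.K i).convex.combo_interior_self_mem_interior (hx i) (hy i)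
    (sub_pos.2 ha.2) ha.1 (sub_add_cancel 1 a)
  have hmem := hadd (Set.add_mem_add hcombo (pb.g_convex i y x a ha.1 ha.2.le))
  rw [show x + a • (y - x) = a • y + (1 - a) • x by module]
  convert hmem using 1
  module

theorem mem_ineqSet_of_mem_dom (hx : x ∈ pb.dom) (i : Fin I) : x ∈ pb.ineqSet i :=
  interior_subset (s := (pb.K i : Set (Vec (pb.q i)))) (hx i)

section Penalized

variable (hf : IsSelfConcordantOn pb.barrier pb.dom)
include hf

theorem isSelfConcordantOn_penalized (η : ℝ) : IsSelfConcordantOn (pb.penalized η) pb.dom :=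
  hf.clm_add (η • innerSL ℝ pb.c)

theorem fderiv_penalized (hx : x ∈ pb.dom) (η : ℝ) (v : Vec N) :
    fderiv ℝ (pb.penalized η) x v = η * pb.cost v + fderiv ℝ pb.barrier x v :=
  DFunLike.congr_fun (hf.fderiv_clm_add hx (η • innerSL ℝ pb.c)) v

theorem fderiv_fderiv_penalized (hx : x ∈ pb.dom) (η : ℝ) :
    fderiv ℝ (fderiv ℝ (pb.penalized η)) x = fderiv ℝ (fderiv ℝ pb.barrier) x :=
  hf.fderiv_fderiv_clm_add hx (η • innerSL ℝ pb.c)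

theorem kkt_eq_kktMatrix_penalized (hx : x ∈ pb.dom) (η : ℝ) :
    pb.kkt x = kktMatrix (pb.penalized η) pb.A x := by
  simp only [kkt, kktMatrix, hessian, fderiv_fderiv_penalized hf hx]

theorem isUnit_kkt (hx : x ∈ pb.dom) : IsUnit (pb.kkt x) :=
  hf.isUnit_kktMatrix (vecMul_injective_of_rank_eq (by rw [pb.A_rank, Fintype.card_fin])) hx

theorem decrementLE_penalized_iff (hx : x ∈ pb.dom) {V : Submodule ℝ (Vec N)} :
    DecrementLE (pb.penalized η) V r x ↔ ∀ v ∈ V,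
      η * pb.cost v + fderiv ℝ pb.barrier x v ≤ r * localNorm pb.barrier x v := by
  simp only [DecrementLE, fderiv_penalized hf hx, localNorm, hessForm,
    fderiv_fderiv_penalized hf hx]

end Penalized

/-- `x` is strictly feasible in round `t` and close to the central path of that round at the
parameter `η`: the Newton decrement of `d_η` along the equality constraints is at most `lam`. -/
structure IsNearCentral (pb : Problem N P I) (η lam : ℝ) (t : ℕ) (x : Vec N) : Prop where
  mem_dom : x ∈ pb.dom
  mulV_eq : mulV pb.A x = pb.b t
  decrementLE : DecrementLE (pb.penalized η) (kernel pb.A) lam x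

namespace IsNearCentral

theorem mono (hx : pb.IsNearCentral η lam t x) (hr : lam ≤ r) : pb.IsNearCentral η r t x :=
  ⟨hx.mem_dom, hx.mulV_eq, hx.decrementLE.mono hr⟩

theorem mem_feasible (hx : pb.IsNearCentral η lam t x) : x ∈ pb.feasible t :=
  ⟨mem_ineqSet_of_mem_dom hx.mem_dom, hx.mulV_eq⟩

theorem sub_mem_kernel (hx : pb.IsNearCentral η lam t x) (hy : y ∈ pb.feasible t) :
    x - y ∈ kernel pb.A := by
  rw [mem_kernel, mulV_sub, hx.mulV_eq, hy.2, sub_self]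

theorem add_newton (hf : IsSelfConcordantOn pb.barrier pb.dom) (hx : pb.IsNearCentral η lam s x)
    (ν : Vec P) {ρ : Fin P → ℝ} (hρ : WithLp.toLp 2 ρ = pb.b s - pb.b t) (hr0 : 0 ≤ r)
    (hr : r < 1 / 2) (hle : lam ^ 2 + ‖Matrix.toEuclideanCLM (n := Fin N ⊕ Fin P) (𝕜 := ℝ)
      (pb.kkt x)⁻¹‖ * ‖pb.b s - pb.b t‖ ^ 2 ≤ r ^ 2) :
    pb.IsNearCentral η (r ^ 2 / (1 - 2 * r)) t (x + primal (-((pb.kkt x)⁻¹ *ᵥ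
      Sum.elim ((gradient (pb.penalized η) x).ofLp + pb.Aᵀ *ᵥ ν.ofLp) ρ))) := by
  have hK := isUnit_kkt hf hx.mem_dom
  have hfη := isSelfConcordantOn_penalized hf η
  rw [kkt_eq_kktMatrix_penalized hf hx.mem_dom η] at hK hle ⊢
  have hstep := hfη.isNewtonStep_kkt hK hx.mem_dom ν ρ
  set h := primal (-((kktMatrix (pb.penalized η) pb.A x)⁻¹ *ᵥ
    Sum.elim ((gradient (pb.penalized η) x).ofLp + pb.Aᵀ *ᵥ ν.ofLp) ρ)) with h_def
  have hAh : mulV pb.A h = pb.b t - pb.b s := by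
    rw [h_def, primal_neg, mulV_neg, ← neg_sub, ← hρ]
    exact congrArg (fun w => -WithLp.toLp 2 w) (mulV_primal_inv_mulVec hK _)
  have hnorm : localNorm (pb.penalized η) x h ≤ r := by
    refine le_of_sq_le_sq ((hfη.localNorm_sq_le_of_isNewtonStep_kernel hK hx.mem_dom hstep
      hx.decrementLE).trans ?_) hr0
    rwa [hAh, norm_sub_rev]
  refine ⟨hfη.add_mem hx.mem_dom (by linarith), by rw [mulV_add, hx.mulV_eq, hAh, add_sub_cancel],
    (hfη.decrementLE_add_of_isNewtonStep hx.mem_dom hstep (by linarith)).mono ?_⟩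
  have := localNorm_nonneg (f := pb.penalized η) (x := x) h
  gcongr
  linarith

theorem tStep (hf : IsSelfConcordantOn pb.barrier pb.dom) {y : Vec N × Vec P}
    (hy : pb.IsNearCentral η (1 / 9) s y.1)
    (hle : ‖Matrix.toEuclideanCLM (n := Fin N ⊕ Fin P) (𝕜 := ℝ) (pb.kkt y.1)⁻¹‖
      * ‖pb.b s - pb.b t‖ ^ 2 ≤ 3 / 160) :
    pb.IsNearCentral η (1 / 20) t (pb.tStep t η y).1 := by
  have hρ : (WithLp.toLp 2 fun k => mulV pb.A y.1 k - pb.b t k) = pb.b s - pb.b t := by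
    rw [← hy.mulV_eq]
    rfl
  exact (hy.add_newton hf y.2 hρ (r := 3 / 17) (by norm_num) (by norm_num)
    (by linarith)).mono (by norm_num)

theorem etaStep (hf : IsSelfConcordantOn pb.barrier pb.dom) (ν : Vec P) {y : Vec N × Vec P}
    (hy : pb.IsNearCentral η (1 / 5) t y.1) :
    pb.IsNearCentral η (1 / 9) t (pb.etaStep η ν y).1 :=
  (hy.add_newton hf ν (t := t) (ρ := 0) (by rw [sub_self, WithLp.toLp_zero]) (r := 1 / 5)
    (by norm_num) (by norm_num) (by simp)).mono (by norm_num)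

theorem mul_eta (hf : IsSelfConcordantOn pb.barrier pb.dom) (hx : pb.IsNearCentral η lam t x)
    (hL : DecrementLE pb.barrier ⊤ L x) (hβ : 1 ≤ β) :
    pb.IsNearCentral (η * β) (β * lam + (β - 1) * L) t x := by
  refine ⟨hx.mem_dom, hx.mulV_eq, (decrementLE_penalized_iff hf hx.mem_dom).2 fun v hv => ?_⟩
  have hcentral := (decrementLE_penalized_iff hf hx.mem_dom).1 hx.decrementLE v hv
  have hbarrier := hL (-v) trivial
  rw [map_neg, localNorm_neg] at hbarrier
  nlinarith

theorem of_matNorm_newton_le (hf : IsSelfConcordantOn pb.barrier pb.dom) (hx : x ∈ pb.dom)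
    (hAx : mulV pb.A x = pb.b t) {ν : Vec P}
    (hle : matNorm (pb.kkt x) (pb.newton t η (x, ν)) ≤ r) : pb.IsNearCentral η r t x := by
  have hK := isUnit_kkt hf hx
  have hfη := isSelfConcordantOn_penalized hf η
  have hAh : mulV pb.A (primal (pb.newton t η (x, ν))) = 0 := by
    rw [newton, primal_neg, mulV_neg, neg_eq_zero]
    refine WithLp.ofLp_injective 2 ((mulV_primal_inv_mulVec hK _).trans ?_)
    rw [residual, Sum.elim_comp_inr, hAx]
    exact funext fun k => sub_self (pb.b t k)
  rw [newton, kkt_eq_kktMatrix_penalized hf hx η] at *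
  rw [matNorm_kktMatrix hAh] at hle
  exact ⟨hx, hAx, (hfη.decrementLE_of_isNewtonStep hx
    (hfη.isNewtonStep_kkt hK hx ν _)).mono hle⟩

end IsNearCentral

theorem RegularUpTo.norm_inv_kkt_mul_sq_le (hreg : pb.RegularUpTo m T) (hm : 0 < m) (ht : t ≤ T)
    (hx : pb.IsNearCentral η lam (t - 1) x) :
    ‖Matrix.toEuclideanCLM (n := Fin N ⊕ Fin P) (𝕜 := ℝ) (pb.kkt x)⁻¹‖
      * ‖pb.b (t - 1) - pb.b t‖ ^ 2 ≤ 3 / 160 := by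
  rcases Nat.eq_zero_or_pos t with rfl | ht0
  · norm_num
  have hinv := hreg.kkt_inv_le (t - 1) (by omega) x hx.mem_feasible hx.mem_dom
  have hstep := hreg.step_le t ht0 ht
  rw [norm_sub_rev]
  calc _ ≤ 1 / m * √(3 * m / 160) ^ 2 := by gcongr
    _ = 3 / 160 := by
      rw [Real.sq_sqrt (by positivity)]
      field_simp

namespace BarrierComplexity

variable (hb : pb.BarrierComplexity vf)
include hb

theorem decrementLE (hx : x ∈ pb.dom) : DecrementLE pb.barrier ⊤ (√vf) x :=
  hb.selfConcordant.decrementLE_sqrt_of_complexity_le hx (hb.complexity_le x hx)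

theorem one_le_sqrt (hx : x ∈ pb.dom) : 1 ≤ √vf :=
  hb.selfConcordant.one_le_of_decrementLE ⟨x, hx⟩ (Nat.zero_lt_of_lt pb.P_lt_N)
    fun _ => hb.decrementLE

theorem mul_cost_sub_le (hx : pb.IsNearCentral η (1 / 9) t x) (hy : y ∈ pb.feasible t) :
    η * (pb.cost x - pb.cost y) ≤ 4 / 3 * vf - localNorm pb.barrier x (y - x) / 18 := by
  have hL := hb.one_le_sqrt hx.mem_dom
  have hbarrier := hb.selfConcordant.fderiv_segment_le_sub hL (fun _ => hb.decrementLE)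
    fun a ha => add_smul_sub_mem_dom hx.mem_dom hy.1 ha
  have hcentral := (decrementLE_penalized_iff hb.selfConcordant hx.mem_dom).1 hx.decrementLE
    (x - y) (hx.sub_mem_kernel hy)
  rw [Real.sq_sqrt (Real.sqrt_pos.1 (by linarith)).le] at hbarrier
  rw [← neg_sub y x, map_neg, localNorm_neg, neg_sub, cost, inner_sub_right] at hcentral
  simp only [cost]
  linarith

theorem cost_sub_le (hη : 0 < η) (hx : pb.IsNearCentral η (1 / 9) t x)
    (hy : y ∈ pb.feasible t) : pb.cost x - pb.cost y ≤ 4 / 3 * vf * η⁻¹ := by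
  rw [← div_eq_mul_inv, le_div_iff₀' hη]
  linarith [hb.mul_cost_sub_le hx hy, localNorm_nonneg (f := pb.barrier) (x := x) (y - x)]

theorem isBounded_sublevel (hη : 0 ≤ η) (hx : pb.IsNearCentral η (1 / 9) t x) :
    Bornology.IsBounded {y | y ∈ pb.feasible t ∧ pb.cost y ≤ pb.cost x} := by
  obtain ⟨κ, hκ, hnorm⟩ := hb.selfConcordant.exists_mul_norm_le_localNorm hx.mem_dom
  refine (Metric.isBounded_iff_subset_closedBall x).2 ⟨24 * vf / κ, fun y ⟨hy, hle⟩ => ?_⟩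
  rw [Metric.mem_closedBall, dist_eq_norm, le_div_iff₀' hκ]
  have := mul_nonneg hη (sub_nonneg.2 hle)
  linarith [hb.mul_cost_sub_le hx hy, hnorm (y - x)]

theorem isBounded_optimal (hη : 0 ≤ η) (hx : pb.IsNearCentral η (1 / 9) t x) :
    Bornology.IsBounded (pb.optimal t) :=
  (hb.isBounded_sublevel hη hx).subset fun _ hy => ⟨hy.1, hy.2 x hx.mem_feasible⟩

theorem optimal_nonempty (hη : 0 ≤ η) (hx : pb.IsNearCentral η (1 / 9) t x)
    (hclosed : IsClosed (pb.feasible t)) : (pb.optimal t).Nonempty := by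
  have hcont : Continuous pb.cost := continuous_const.inner continuous_id
  obtain ⟨z, hz, hmin⟩ := hcont.continuousOn.exists_isMinOn' hclosed hx.mem_feasible <| by
    rw [← Metric.cobounded_eq_cocompact, Filter.eventually_inf_principal]
    filter_upwards [hb.isBounded_sublevel hη hx] with y hy hyt
    exact (not_le.1 fun hle => hy ⟨hyt, hle⟩).le
  exact ⟨z, hz, hmin⟩

theorem sub_one_mul_sqrt_le (hβ : β ≤ 1 + 1 / (8 * √vf)) (hx : x ∈ pb.dom) :
    (β - 1) * √vf ≤ 1 / 8 := by
  have hL := hb.one_le_sqrt hx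
  rw [← le_div_iff₀ (by linarith), div_div]
  linarith

theorem isNearCentral_mul_eta (hβ : 1 ≤ β) (hβ' : β ≤ 1 + 1 / (8 * √vf))
    (hx : pb.IsNearCentral η (1 / 20) t x) : pb.IsNearCentral (η * β) (1 / 5) t x := by
  have hL := hb.one_le_sqrt hx.mem_dom
  have hprod := hb.sub_one_mul_sqrt_le hβ' hx.mem_dom
  exact (hx.mul_eta hb.selfConcordant (hb.decrementLE hx.mem_dom) hβ).mono (by nlinarith)

end BarrierComplexity

theorem eta_pos (hη₀ : 0 < η₀) (hβ : 0 < β) : ∀ t, 0 < eta η₀ β t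
  | 0 => hη₀
  | t + 1 => mul_pos (eta_pos hη₀ hβ t) hβ

theorem sub_one_mul_sum_inv_eta (hη₀ : η₀ ≠ 0) (hβ : β ≠ 0) (T : ℕ) :
    (β - 1) * ∑ t ∈ Finset.Icc 1 T, (eta η₀ β t)⁻¹ = η₀⁻¹ - (eta η₀ β T)⁻¹ := by
  induction T with
  | zero => simp [eta]
  | succ T ih =>
    rw [Finset.sum_Icc_succ_top (by omega), mul_add, ih, eta, mul_inv]
    field_simp
    ring

section Run

variable {y₀ : Vec N × Vec P} (hb : pb.BarrierComplexity vf) (hm : 0 < m) (hβ : 1 ≤ β)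
  (hβ' : β ≤ 1 + 1 / (8 * √vf)) (h₀ : pb.IsNearCentral η₀ (1 / 9) 0 y₀.1)
  (hreg : pb.RegularUpTo m T)
include hb hm hreg

theorem isNearCentral_mid (ht : t ≤ T)
    (h : pb.IsNearCentral (eta η₀ β t) (1 / 9) (t - 1) (pb.iter η₀ β y₀ t).1) :
    pb.IsNearCentral (eta η₀ β t) (1 / 20) t (pb.mid η₀ β y₀ t).1 :=
  h.tStep hb.selfConcordant (hreg.norm_inv_kkt_mul_sq_le hm ht h)

include hβ hβ' h₀

theorem isNearCentral_iter : ∀ t ≤ T,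
    pb.IsNearCentral (eta η₀ β t) (1 / 9) (t - 1) (pb.iter η₀ β y₀ t).1
  | 0, _ => h₀
  | t + 1, ht =>
    have hmid := isNearCentral_mid hb hm hreg (by omega) (isNearCentral_iter t (by omega))
    (hb.isNearCentral_mul_eta hβ hβ' hmid).etaStep hb.selfConcordant _

theorem optimal_nonempty_and_isBounded (hη₀ : 0 < η₀) (ht : t ≤ T) :
    (pb.optimal t).Nonempty ∧ Bornology.IsBounded (pb.optimal t) := by
  have hη := (eta_pos hη₀ (by linarith : 0 < β) t).le
  have hmid := isNearCentral_mid hb hm hreg ht (isNearCentral_iter hb hm hβ hβ' h₀ hreg t ht)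
  have hmid' := hmid.mono (r := 1 / 9) (by norm_num)
  exact ⟨hb.optimal_nonempty hη hmid' (hreg.closed t ht), hb.isBounded_optimal hη hmid'⟩

end Run

theorem abs_cost_sub_le_of_mem_optimal (hx : x ∈ pb.optimal s) (hy : y ∈ pb.optimal t)
    (hs : Bornology.IsBounded (pb.optimal s)) (ht : Bornology.IsBounded (pb.optimal t)) :
    |pb.cost x - pb.cost y| ≤ ‖pb.c‖ * Metric.hausdorffDist (pb.optimal s) (pb.optimal t) := by
  have hlip : LipschitzWith ‖pb.c‖₊ pb.cost := LipschitzWith.of_dist_le_mul fun u v => by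
    rw [Real.dist_eq, cost, cost, ← inner_sub_right, dist_eq_norm]
    exact abs_real_inner_le_norm _ _
  exact abs_sub_le_mul_hausdorffDist hlip hx hy
    (fun z hz => le_antisymm (hz.2 y hy.1) (hy.2 z hz.1)) hs ht

theorem optVariation_nonneg (T : ℕ) : 0 ≤ pb.optVariation T :=
  Finset.sum_nonneg fun _ _ => Metric.hausdorffDist_nonneg

theorem abs_regret_le (hb : pb.BarrierComplexity vf) (hvf : 0 ≤ vf) (hη₀ : 0 < η₀) (hβ : 1 < β)
    {x xs : ℕ → Vec N}
    (hx : ∀ t, 1 ≤ t → t ≤ T → pb.IsNearCentral (eta η₀ β t) (1 / 9) (t - 1) (x t))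
    (hopt : ∀ t ≤ T, (pb.optimal t).Nonempty ∧ Bornology.IsBounded (pb.optimal t))
    (hxs : ∀ t, 1 ≤ t → t ≤ T → xs t ∈ pb.optimal t) :
    |pb.regret x xs T| ≤ 4 / 3 * vf / (η₀ * (β - 1)) + ‖pb.c‖ * pb.optVariation T := by
  have hη := eta_pos hη₀ (zero_lt_one.trans hβ)
  have hround : ∀ t ∈ Finset.Icc 1 T, |pb.cost (x t) - pb.cost (xs t)| ≤
      4 / 3 * vf * (eta η₀ β t)⁻¹
        + ‖pb.c‖ * Metric.hausdorffDist (pb.optimal t) (pb.optimal (t - 1)) := fun t ht => by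
    obtain ⟨ht1, htT⟩ := Finset.mem_Icc.1 ht
    obtain ⟨⟨z, hz⟩, hbdd⟩ := hopt (t - 1) (by omega)
    have hgap := hb.cost_sub_le (hη t) (hx t ht1 htT) hz.1
    have hmin := hz.2 _ (hx t ht1 htT).mem_feasible
    have hvar := abs_cost_sub_le_of_mem_optimal hz (hxs t ht1 htT) hbdd (hopt t htT).2
    rw [Metric.hausdorffDist_comm, abs_le] at hvar
    exact abs_le.2 ⟨by linarith, by linarith⟩
  have hsum : ∑ t ∈ Finset.Icc 1 T, (eta η₀ β t)⁻¹ ≤ η₀⁻¹ / (β - 1) := by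
    rw [le_div_iff₀' (sub_pos.2 hβ), sub_one_mul_sum_inv_eta hη₀.ne' (by linarith)]
    linarith [inv_pos.2 (hη T)]
  calc |pb.regret x xs T|
      ≤ ∑ t ∈ Finset.Icc 1 T, |pb.cost (x t) - pb.cost (xs t)| := Finset.abs_sum_le_sum_abs _ _
    _ ≤ 4 / 3 * vf * ∑ t ∈ Finset.Icc 1 T, (eta η₀ β t)⁻¹ + ‖pb.c‖ * pb.optVariation T := by
        rw [optVariation, Finset.mul_sum, Finset.mul_sum, ← Finset.sum_add_distrib]
        exact Finset.sum_le_sum hround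
    _ ≤ 4 / 3 * vf * (η₀⁻¹ / (β - 1)) + ‖pb.c‖ * pb.optVariation T := by gcongr
    _ = _ := by rw [← div_div, mul_div_assoc', ← div_eq_mul_inv]

theorem four_thirds_mul_div_le (hvf : 0 ≤ vf) (hη₀ : 0 < η₀) (hβ : 1 < β) :
    4 / 3 * vf / (η₀ * (β - 1)) ≤ 11 * vf * β / (5 * η₀ * (β - 1)) := by
  rw [mul_assoc 5, ← div_div _ 5]
  have := sub_pos.2 hβ
  gcongr
  nlinarith

theorem violation_eq_rhsVariation {x : ℕ → Vec N}
    (hx : ∀ t, 1 ≤ t → t ≤ T → x t ∈ pb.dom ∧ mulV pb.A (x t) = pb.b (t - 1)) :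
    pb.violation x T = pb.rhsVariation T :=
  Finset.sum_congr rfl fun t ht => by
    obtain ⟨ht1, htT⟩ := Finset.mem_Icc.1 ht
    obtain ⟨hdom, hA⟩ := hx t ht1 htT
    rw [hA, norm_sub_rev, add_eq_right]
    exact Finset.sum_eq_zero fun i _ => Metric.infDist_zero_of_mem (mem_ineqSet_of_mem_dom hdom i)

end Problem

end OIPM

theorem theorem1 {N P I : ℕ} (pb : OIPM.Problem N P I) (vf m β η₀ : ℝ)
    (x₀ : OIPM.Vec N) (ν₀ : OIPM.Vec P)
    (hvf : 0 < vf) (hm : 0 < m) (hη₀ : 0 < η₀)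
    (hβ : 1 < β) (hβ' : β ≤ 1 + 1 / (8 * Real.sqrt vf))
    (hbarrier : pb.BarrierComplexity vf)
    (hx₀ : x₀ ∈ pb.dom) (hAx₀ : OIPM.mulV pb.A x₀ = pb.b 0)
    (hinit : OIPM.matNorm (pb.kkt x₀) (pb.newton 0 η₀ (x₀, ν₀)) ≤ 1 / 9) :
    (∀ T : ℕ, pb.RegularUpTo m T →
      -- the run is well defined, and the sets of optimal decisions are nonempty and bounded
      (∀ t ≤ T,
        ((pb.iter η₀ β (x₀, ν₀) t).1 ∈ pb.dom ∧
          IsUnit (pb.kkt (pb.iter η₀ β (x₀, ν₀) t).1)) ∧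
        ((pb.mid η₀ β (x₀, ν₀) t).1 ∈ pb.dom ∧
          IsUnit (pb.kkt (pb.mid η₀ β (x₀, ν₀) t).1)) ∧
        (pb.optimal t).Nonempty ∧ Bornology.IsBounded (pb.optimal t)) ∧
      -- the regret bound
      (∀ xs : ℕ → OIPM.Vec N, (∀ t, 1 ≤ t → t ≤ T → xs t ∈ pb.optimal t) →
        pb.regret (fun t => (pb.iter η₀ β (x₀, ν₀) t).1) xs T
          ≤ 11 * vf * β / (5 * η₀ * (β - 1)) + ‖pb.c‖ * pb.optVariation T) ∧
      -- the constraint violation bound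
      pb.violation (fun t => (pb.iter η₀ β (x₀, ν₀) t).1) T ≤ pb.rhsVariation T) ∧
    -- the orders of growth, when the assumptions hold in all rounds
    ((∀ T : ℕ, pb.RegularUpTo m T) →
      (∀ xs : ℕ → OIPM.Vec N, (∀ t, 1 ≤ t → xs t ∈ pb.optimal t) →
        (fun T : ℕ => pb.regret (fun t => (pb.iter η₀ β (x₀, ν₀) t).1) xs T)
          =O[atTop] (fun T : ℕ => pb.optVariation T + 1)) ∧
      (fun T : ℕ => pb.violation (fun t => (pb.iter η₀ β (x₀, ν₀) t).1) T)
        =O[atTop] (fun T : ℕ => pb.rhsVariation T)) := by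
  have h₀ : pb.IsNearCentral η₀ (1 / 9) 0 (x₀, ν₀).1 :=
    .of_matNorm_newton_le hbarrier.selfConcordant hx₀ hAx₀ hinit
  have hunit := fun {x} => OIPM.Problem.isUnit_kkt (x := x) hbarrier.selfConcordant
  have hiter := fun T => OIPM.Problem.isNearCentral_iter (T := T) hbarrier hm hβ.le hβ' h₀
  have hmid := fun T hreg t ht =>
    OIPM.Problem.isNearCentral_mid hbarrier hm hreg ht (hiter T hreg t ht)
  have hopt := fun T hreg t =>
    OIPM.Problem.optimal_nonempty_and_isBounded (t := t) (T := T) hbarrier hm hβ.le hβ' h₀ hreg hη₀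
  have hregret := fun T hreg xs => OIPM.Problem.abs_regret_le (xs := xs) hbarrier hvf.le hη₀ hβ
    (fun t _ => hiter T hreg t) (hopt T hreg)
  have hvio := fun T hreg => OIPM.Problem.violation_eq_rhsVariation (pb := pb) fun t _ ht =>
    ⟨(hiter T hreg t ht).mem_dom, (hiter T hreg t ht).mulV_eq⟩
  refine ⟨fun T hreg => ⟨fun t ht => ?_, fun xs hxs => ?_, (hvio T hreg).le⟩, fun hreg =>
    ⟨fun xs hxs => OIPM.isBigO_add_one_of_abs_le OIPM.Problem.optVariation_nonneg fun T =>
      hregret T (hreg T) xs fun t ht _ => hxs t ht, ?_⟩⟩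
  · have hx := (hiter T hreg t ht).mem_dom
    have hx' := (hmid T hreg t ht).mem_dom
    exact ⟨⟨hx, hunit hx⟩, ⟨hx', hunit hx'⟩, hopt T hreg t ht⟩
  · linarith [le_abs_self (pb.regret (fun t => (pb.iter η₀ β (x₀, ν₀) t).1) xs T),
      hregret T hreg xs hxs, OIPM.Problem.four_thirds_mul_div_le hvf.le hη₀ hβ]
  · simpa only [hvio _ (hreg _)] using isBigO_refl _ _
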